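/- Let $q$ be real with $0<|q|<1$, let $a\in\mathbb{R}$ and $\lambda<0$. Write $(c;q)_n=\prod_{i=0}^{n-1}(1-cq^i)$, and ${n \brack k}_q=\dfrac{(q;q)_n}{(q;q)_k(q;q)_{n-k}}$ for $0\le k\le n$, ${n \brack k}_q=0$ for $n<k$. Let $Q_n(x)$ be the denominator polynomials of the continued fraction $$\frac{1}{x+a}\;{\atop +}\;\frac{\lambda q}{x+aq}\;{\atop +}\;\frac{\lambda q^2}{x+aq^2}\;{\atop +\cdots},$$ that is, $Q_0(x)=1$, $Q_1(x)=x+a$ and $Q_{k+1}(x)=(x+aq^k)Q_k(x)+\lambda q^kQ_{k-1}(x)$ for $k>0$. Then for every $n\ge 0$, as polynomials in $x$, $$Q_n(x)=\sum_{j=0}^{n}\sum_{k=j}^{n-j}{k\brack j}_q{n-j\brack k}_q a^{k-j}x^{n-j-k}\lambda^j q^{\binom k2+\binom j2+j},$$ and, for every real $x\ne 0$ with $(-a/x;q)_j\neq 0$ for all $0\le j\le n/2$, $$Q_n(x)=\sum_{0\le j\le n/2}{n-j\brack j}_q\frac{(-a/x;q)_{n-j}}{(-a/x;q)_j}\lambda^j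 x^{n-2j}q^{j^2}.$$ If moreover $q>0$ (equivalently, $-\lambda q^k>0$ for all $k\ge1$), then there is a purely discrete positive measure $\mu$ on $\mathbb{R}$ (a countable sum of point masses) such that, for all $n,m\ge0$, the product $Q_nQ_m$ is $\mu$-integrable and $$\int_{-\infty}^{\infty}Q_n(x)Q_m(x)\,d\mu(x)=(-\lambda)^n q^{\binom{n+1}{2}}\delta_{mn}.$$ -/

import Mathlib

open MeasureTheory Polynomial

/-- The `q`-rising factorial `(a; q)_n = (1 - a)(1 - a q) ⋯ (1 - a q ^ (n - 1))`. -/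
noncomputable def qRising (a q : ℝ) (n : ℕ) : ℝ :=
  ∏ i ∈ Finset.range n, (1 - a * q ^ i)

/-- The `q`-binomial coefficient `(q; q)_n / ((q; q)_k (q; q)_{n - k})`, equal to `0` for `n < k`. -/
noncomputable def qBinom (q : ℝ) (n k : ℕ) : ℝ :=
  if k ≤ n then qRising q q n / (qRising q q k * qRising q q (n - k)) else 0

/-- The denominator polynomials `Q_n` of the J-fraction
`1 / (x + a) + lam q / (x + a q) + lam q ^ 2 / (x + a q ^ 2) + ⋯`:
`Q_0 = 1`, `Q_1 = x + a` and `Q_{k+1} = (x + a q ^ k) Q_k + lam q ^ k Q_{k-1}` for `k > 0`. -/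
noncomputable def denomPoly (q a lam : ℝ) : ℕ → ℝ[X]
  | 0 => 1
  | 1 => X + C a
  | k + 2 => (X + C (a * q ^ (k + 1))) * denomPoly q a lam (k + 1)
      + C (lam * q ^ (k + 1)) * denomPoly q a lam k

/-- A (positive) measure on the line is purely discrete if it is carried by a countable set,
that is, if it is a countable sum of point masses. -/
def IsPurelyDiscrete (μ : Measure ℝ) : Prop :=
  ∃ S : Set ℝ, S.Countable ∧ μ Sᶜ = 0

/-! Orthogonality is spectral theory. For `q > 0` the recurrence is that of a Jacobi matrix with
diagonal `-a q^k` and off-diagonal entries `c_k`, where `c_k² = -lam q^(k+1)`. Both sequences decay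
geometrically, so the matrix is a compact symmetric operator `T` on ℓ², and the recurrence gives
`Q_n(T) e_0 = c_0 ⋯ c_{n-1} e_n`. The spectral measure of `T` at `e_0` sits on countably many
eigenvalues and integrates `p` to `⟨e_0, p(T) e_0⟩`. Hence `∫ Q_n Q_m = ⟨Q_n(T) e_0, Q_m(T) e_0⟩`,
and the `e_n` are orthonormal.

Both explicit formulas hold term by term: by the two q-Pascal rules the summands satisfy the
recurrence of `Q_n` up to index shifts (`denomTerm_succ_succ_succ`, `denomProdTerm_succ_succ`). -/

/-! ### Spectral measures of compact symmetric operators -/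

section SpectralMeasure

open Module.End InnerProductSpace

variable {E : Type*} [NormedAddCommGroup E] [InnerProductSpace ℝ E] [CompleteSpace E]

/-- A compact symmetric operator has a decomposition of every vector into orthogonal
eigenvectors. -/
theorem exists_hasSum_eigenvectors {T : E →L[ℝ] E} (hT : IsCompactOperator T)
    (hs : T.IsSymmetric) (v : E) :
    ∃ w : ℝ → E, HasSum w v ∧ (∀ t, T (w t) = t • w t) ∧
      (∀ t, inner ℝ v (w t) = ‖w t‖ ^ 2) ∧ Summable fun t => ‖w t‖ ^ 2 := by
  classical
  have hV := hs.orthogonalFamily_eigenspaces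
  have : ∀ t : ℝ, CompleteSpace (eigenspace (T : Module.End ℝ E) t) := fun t => by
    have : IsClosed ((eigenspace (T : Module.End ℝ E) t : Submodule ℝ E) : Set E) := by
      have h : ((eigenspace (T : Module.End ℝ E) t : Submodule ℝ E) : Set E)
          = {x | T x = t • x} := by
        ext x
        simp
      rw [h]
      exact isClosed_eq T.continuous (continuous_const_smul t)
    exact this.completeSpace_coe
  have hH : IsHilbertSum ℝ (fun t : ℝ => eigenspace (T : Module.End ℝ E) t)
      fun t => (eigenspace (T : Module.End ℝ E) t).subtypeₗᵢ := by
    refine IsHilbertSum.mkInternal (fun t : ℝ => eigenspace (T : Module.End ℝ E) t) hV ?_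
    rw [← Submodule.orthogonal_orthogonal_eq_closure,
      ContinuousLinearMap.orthogonalComplement_iSup_eigenspaces_eq_bot hT hs]
    simp
  obtain ⟨f, hf⟩ := hH.surjective_isometry v
  -- The component `f t` is the orthogonal projection of `v` onto the `t`-eigenspace.
  have hin : ∀ t, inner ℝ v (f t : E) = ‖(f t : E)‖ ^ 2 := fun t => by
    have h1 : (f t : E) = hH.OrthogonalFamily.linearIsometry (lp.single 2 t (f t)) := by
      rw [OrthogonalFamily.linearIsometry_apply_single]
      rfl
    have h2 : inner ℝ v (f t : E) = inner ℝ (f t) (f t) := by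
      rw [h1, ← hf, LinearIsometry.inner_map_map, lp.inner_single_right]
    rw [h2, real_inner_self_eq_norm_sq]
    rfl
  refine ⟨fun t => (f t : E), ?_, fun t => ?_, hin, ?_⟩
  · have := hH.OrthogonalFamily.hasSum_linearIsometry f
    rw [hf] at this
    exact this
  · exact mem_eigenspace_iff.1 (f t).2
  · have := hH.OrthogonalFamily.hasSum_linearIsometry f
    rw [hf] at this
    have h3 := (this.mapL (innerSL ℝ v)).summable
    refine h3.congr fun t => ?_
    simpa using hin t

/-- The spectral measure of a compact symmetric operator at a vector is purely discrete. -/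
theorem exists_isPurelyDiscrete_integral_eval_eq_inner {T : E →L[ℝ] E}
    (hT : IsCompactOperator T) (hs : T.IsSymmetric) (v : E) :
    ∃ μ : Measure ℝ, IsPurelyDiscrete μ ∧ ∀ p : ℝ[X],
      Integrable (fun x => p.eval x) μ ∧ ∫ x, p.eval x ∂μ = inner ℝ v (aeval T p v) := by
  obtain ⟨w, hw, hTw, hin, hsum⟩ := exists_hasSum_eigenvectors hT hs v
  have hS : {t | w t ≠ 0}.Countable :=
    hsum.countable_support.mono fun t ht => by simpa using ht
  have hpw : ∀ (p : ℝ[X]) t, aeval T p (w t) = p.eval t • w t := fun p t => by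
    induction p using Polynomial.induction_on' with
    | add p r hp hr => simp [hp, hr, add_smul]
    | monomial n c =>
      have : ∀ n : ℕ, (T ^ n) (w t) = t ^ n • w t := fun n => by
        induction n with
        | zero => simp
        | succ n ih => rw [pow_succ', mul_apply_eq_comp, ih, map_smul, hTw, smul_smul,
            pow_succ]
      rw [aeval_monomial, eval_monomial, mul_apply_eq_comp, this,
        Algebra.algebraMap_eq_smul_one, smul_apply,
        one_apply_eq_self, smul_smul]
  have hasSum : ∀ p : ℝ[X],
      HasSum (fun t => ‖w t‖ ^ 2 * p.eval t) (inner ℝ v (aeval T p v)) := fun p => by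
    have := (hw.mapL (aeval T p)).mapL (innerSL ℝ v)
    refine this.congr_fun fun t => ?_
    simp [hpw, hin, mul_comm]
  let S := {t | w t ≠ 0}
  have : Countable S := hS.to_subtype
  -- The mass at an eigenvalue is the squared norm of the component of `v` in its eigenspace.
  let c : S → ENNReal := fun t => ENNReal.ofReal (‖w t‖ ^ 2)
  have hc : ∀ t, c t ≠ ⊤ := fun t => ENNReal.ofReal_ne_top
  have hcr : ∀ t, (c t).toReal = ‖w t‖ ^ 2 := fun t => ENNReal.toReal_ofReal (sq_nonneg _)
  refine ⟨Measure.sum fun t : S => c t • Measure.dirac (t : ℝ), ⟨S, hS, ?_⟩, fun p => ⟨?_, ?_⟩⟩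
  · rw [Measure.sum_apply _ hS.measurableSet.compl]
    simp [hS.measurableSet.compl]
  · refine integrable_sum_dirac hc ?_
    have := (hasSum p).summable.abs.subtype S
    refine this.congr fun t => ?_
    simp [hcr, abs_mul]
  · rw [integral_sum_dirac hc, ← (hasSum p).tsum_eq]
    have hsupp : Function.support (fun t => ‖w t‖ ^ 2 * p.eval t) ⊆ S := fun t ht h0 => by
      simp_all
    rw [← tsum_subtype_eq_of_support_subset hsupp]
    simp [hcr]

end SpectralMeasure

/-! ### Compact Jacobi operators -/

section Jacobi

open InnerProductSpace

variable {E : Type*} [NormedAddCommGroup E] [InnerProductSpace ℝ E]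

theorem isCompactOperator_rankOne (x y : E) : IsCompactOperator (rankOne ℝ x y) := by
  have : IsCompactOperator (ContinuousLinearMap.toSpanSingleton ℝ x) :=
    isCompactOperator_id.clm_comp _
  exact this.comp_clm (innerSL ℝ y)

/-- A Jacobi matrix with summable entries defines a compact symmetric operator. -/
theorem exists_jacobi_operator [CompleteSpace E] {e : ℕ → E} (he : Orthonormal ℝ e) {b c : ℕ → ℝ}
    (hb : Summable b) (hc : Summable c) :
    ∃ T : E →L[ℝ] E, IsCompactOperator T ∧ T.IsSymmetric ∧
      T (e 0) = b 0 • e 0 + c 0 • e 1 ∧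
      ∀ k, T (e (k + 1)) = c k • e k + b (k + 1) • e (k + 1) + c (k + 1) • e (k + 2) := by
  -- Finite-rank pieces whose norms are summable, so their sum is a norm limit of compact operators.
  let R : ℕ → E →L[ℝ] E := fun k => b k • rankOne ℝ (e k) (e k) +
    c k • (rankOne ℝ (e k) (e (k + 1)) + rankOne ℝ (e (k + 1)) (e k))
  have hR : Summable R := by
    refine Summable.add ?_ ?_
    · refine Summable.of_norm (hb.abs.congr fun k => ?_)
      simp [norm_smul, he.1]
    · refine Summable.of_norm_bounded (hc.abs.mul_right 2) fun k => ?_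
      rw [norm_smul]
      refine mul_le_mul_of_nonneg_left ((norm_add_le _ _).trans ?_) (abs_nonneg _)
      simp [he.1]
      norm_num
  have hRs : ∀ k x y, inner ℝ (R k x) y = inner ℝ x (R k y) := fun k x y => by
    simp [R, inner_add_left, inner_add_right, inner_smul_left, inner_smul_right,
      real_inner_comm]
    ring
  have hval : ∀ x, HasSum (fun k => R k x) ((∑' k, R k) x) := fun x =>
    hR.hasSum.mapL (ContinuousLinearMap.apply ℝ E x)
  have hee : ∀ i j, inner ℝ (e i) (e j) = if i = j then (1 : ℝ) else 0 :=
    orthonormal_iff_ite.1 he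
  refine ⟨∑' k, R k, ?_, ?_, ?_, fun k => ?_⟩
  · refine isCompactOperator_of_tendsto hR.hasSum (Filter.Eventually.of_forall fun s => ?_)
    have : ∀ k, R k ∈ compactOperator (RingHom.id ℝ) E E := fun k => by
      refine add_mem (Submodule.smul_mem _ _ (isCompactOperator_rankOne _ _))
        (Submodule.smul_mem _ _ (add_mem ?_ ?_)) <;> exact isCompactOperator_rankOne _ _
    exact sum_mem (S := compactOperator (RingHom.id ℝ) E E) fun k _ => this k
  · intro x y
    have h1 := (hval x).mapL (innerSL ℝ y)
    have h2 := (hval y).mapL (innerSL ℝ x)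
    have h3 : HasSum (fun k => inner ℝ (R k x) y) (inner ℝ ((∑' k, R k) x) y) := by
      simpa only [innerSL_apply_apply, real_inner_comm] using h1
    exact h3.unique (h2.congr_fun fun k => hRs k x y)
  · refine (hval (e 0)).unique ?_
    have : HasSum (fun k => R k (e 0)) (∑ k ∈ {0}, R k (e 0)) :=
      hasSum_sum_of_ne_finset_zero fun k hk => by
        have : k ≠ 0 := by simpa using hk
        simp [R, hee, this]
    simpa [R, hee] using this
  · refine (hval (e (k + 1))).unique ?_
    have : HasSum (fun i => R i (e (k + 1))) (∑ i ∈ {k, k + 1}, R i (e (k + 1))) :=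
      hasSum_sum_of_ne_finset_zero fun i hi => by
        have : i ≠ k ∧ i ≠ k + 1 := by simpa using hi
        simp [R, hee, this.1, this.2]
    convert this using 1
    rw [Finset.sum_pair (by simp)]
    simp [R, hee, he.1, add_assoc]

end Jacobi

/-! ### Orthogonality of the denominator polynomials -/

theorem exists_isPurelyDiscrete_orthogonality {q lam : ℝ} (a : ℝ) (hq0 : 0 < q) (hq1 : q < 1)
    (hlam : lam < 0) : ∃ μ : Measure ℝ, IsPurelyDiscrete μ ∧ ∀ n m : ℕ,
      Integrable (fun x => (denomPoly q a lam n).eval x * (denomPoly q a lam m).eval x) μ ∧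
      ∫ x, (denomPoly q a lam n).eval x * (denomPoly q a lam m).eval x ∂μ =
        if n = m then (-lam) ^ n * q ^ ((n + 1).choose 2) else 0 := by
  let e : ℕ → lp (fun _ : ℕ => ℝ) 2 := fun k => lp.single 2 k (1 : ℝ)
  have he : Orthonormal ℝ e := by
    rw [orthonormal_iff_ite]
    intro i j
    rw [lp.inner_single_left, lp.single_apply]
    by_cases h : i = j
    · subst h; simp
    · simp [h]
  -- This is `√(-lam q^(k+1))`, written as a geometric sequence to make summability immediate.
  let c : ℕ → ℝ := fun k => √(-lam * q) * √q ^ k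
  have hc2 : ∀ k, c k * c k = -lam * q ^ (k + 1) := fun k => by
    have h1 : √(-lam * q) ^ 2 = -lam * q := Real.sq_sqrt (by nlinarith)
    have h2 : √q ^ 2 = q := Real.sq_sqrt hq0.le
    calc c k * c k = √(-lam * q) ^ 2 * (√q ^ 2) ^ k := by simp only [c]; ring
      _ = _ := by rw [h1, h2]; ring
  have hb : Summable fun k : ℕ => -a * q ^ k :=
    (summable_geometric_of_lt_one hq0.le hq1).mul_left _
  have hc : Summable c := by
    refine (summable_geometric_of_lt_one (Real.sqrt_nonneg q) ?_).mul_left _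
    rw [Real.sqrt_lt' one_pos]
    simpa using hq1
  obtain ⟨T, hTc, hTs, hT0, hT1⟩ := exists_jacobi_operator he hb hc
  have key : ∀ n, aeval T (denomPoly q a lam n) (e 0) = (∏ i ∈ Finset.range n, c i) • e n ∧
      aeval T (denomPoly q a lam (n + 1)) (e 0) = (∏ i ∈ Finset.range (n + 1), c i) • e (n + 1) := by
    intro n
    induction n with
    | zero =>
      simp [denomPoly, hT0, Algebra.algebraMap_eq_smul_one]
    | succ n ih =>
      refine ⟨ih.2, ?_⟩
      rw [denomPoly]
      simp only [map_add, map_mul, aeval_X, aeval_C, add_apply,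
        mul_apply_eq_comp, ih.1, ih.2, Algebra.algebraMap_eq_smul_one,
        smul_apply, one_apply_eq_self, map_smul, hT1,
        Finset.prod_range_succ]
      have := hc2 n
      match_scalars
      -- In the `e n` coefficient, `c n ^ 2` from `T` cancels `lam * q ^ (n + 1)` from the
      -- recurrence.
      · linear_combination (∏ i ∈ Finset.range n, c i) * this
      · ring
      · ring
  obtain ⟨μ, hμ, h⟩ := exists_isPurelyDiscrete_integral_eval_eq_inner hTc hTs (e 0)
  refine ⟨μ, hμ, fun n m => ?_⟩
  simp only [← eval_mul]
  refine ⟨(h _).1, ?_⟩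
  have hsymm : ∀ (p : ℝ[X]) x y, inner ℝ (aeval T p x) y = inner ℝ x (aeval T p y) := fun p => by
    have hpow : ∀ (n : ℕ) x y, inner ℝ ((T ^ n) x) y = inner ℝ x ((T ^ n) y) := fun n => by
      induction n with
      | zero => simp
      | succ n ih =>
        intro x y
        have : (T ^ (n + 1)) y = T ((T ^ n) y) := by rw [pow_succ', mul_apply_eq_comp]
        rw [this, pow_succ, mul_apply_eq_comp, ih]
        exact hTs _ _
    induction p using Polynomial.induction_on' with
    | add p r hp hr => intro x y; simp [inner_add_left, inner_add_right, hp, hr]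
    | monomial n t =>
      intro x y
      rw [aeval_monomial, Algebra.algebraMap_eq_smul_one, smul_mul_assoc, one_mul, smul_apply,
        smul_apply, inner_smul_left, inner_smul_right, hpow]
      rfl
  rw [(h _).2, map_mul, mul_apply_eq_comp, ← hsymm, (key n).1, (key m).1,
    inner_smul_left, inner_smul_right, orthonormal_iff_ite.1 he]
  split_ifs with hnm
  · subst hnm
    have : ∀ n : ℕ, (∏ i ∈ Finset.range n, c i) * (∏ i ∈ Finset.range n, c i) =
        (-lam) ^ n * q ^ ((n + 1).choose 2) := fun n => by
      induction n with
      | zero => simp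
      | succ n ih =>
        rw [Finset.prod_range_succ, mul_mul_mul_comm, ih, hc2, Nat.choose_succ_succ' (n + 1),
          Nat.choose_one_right]
        ring
    simpa using this n
  · simp

/-! ### The q-Pascal rules -/

section QBinom

variable {q : ℝ}

theorem qRising_succ (c q : ℝ) (n : ℕ) : qRising c q (n + 1) = qRising c q n * (1 - c * q ^ n) :=
  Finset.prod_range_succ _ _

theorem one_sub_mul_pow_ne_zero (hq : |q| < 1) (n : ℕ) : 1 - q * q ^ n ≠ 0 := by
  intro h
  have h1 : |q| ^ (n + 1) < 1 := pow_lt_one₀ (abs_nonneg q) hq n.succ_ne_zero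
  rw [← abs_pow, pow_succ', show q * q ^ n = 1 by linarith, abs_one] at h1
  exact lt_irrefl _ h1

theorem qRising_self_ne_zero (hq : |q| < 1) (n : ℕ) : qRising q q n ≠ 0 :=
  Finset.prod_ne_zero_iff.2 fun i _ => one_sub_mul_pow_ne_zero hq i

theorem qBinom_of_lt {n k : ℕ} (h : n < k) : qBinom q n k = 0 := if_neg h.not_ge

theorem qBinom_zero_right (hq : |q| < 1) (n : ℕ) : qBinom q n 0 = 1 := by
  have := qRising_self_ne_zero hq n
  rw [qBinom, if_pos n.zero_le, Nat.sub_zero, show qRising q q 0 = 1 from rfl, one_mul, div_self this]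

theorem qBinom_self (hq : |q| < 1) (n : ℕ) : qBinom q n n = 1 := by
  have := qRising_self_ne_zero hq n
  rw [qBinom, if_pos le_rfl, Nat.sub_self, show qRising q q 0 = 1 from rfl, mul_one, div_self this]

/-- The `q`-Pascal rule with the power of `q` on the first summand. -/
theorem qBinom_succ_succ (hq : |q| < 1) (n k : ℕ) :
    qBinom q (n + 1) (k + 1) = q ^ (k + 1) * qBinom q n (k + 1) + qBinom q n k := by
  rcases lt_trichotomy n k with h | rfl | h
  · simp [qBinom_of_lt, h, h.trans k.lt_succ_self]
  · simp [qBinom_self hq, qBinom_of_lt]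
  · obtain ⟨m, rfl⟩ := Nat.exists_eq_add_of_lt h
    have e1 : k + m + 1 + 1 - (k + 1) = m + 1 := by lia
    have e2 : k + m + 1 - (k + 1) = m := by lia
    have e3 : k + m + 1 - k = m + 1 := by lia
    rw [qBinom, qBinom, qBinom, if_pos (by lia), if_pos (by lia), if_pos (by lia), e1, e2, e3]
    have h1 := qRising_self_ne_zero hq k
    have h2 := qRising_self_ne_zero hq m
    have h3 := one_sub_mul_pow_ne_zero hq k
    have h4 := one_sub_mul_pow_ne_zero hq m
    rw [qRising_succ q q (k + m + 1), qRising_succ q q k, qRising_succ q q m]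
    field_simp
    ring

/-- The `q`-Pascal rule with the power of `q` on the second summand. -/
theorem qBinom_succ_succ' (hq : |q| < 1) {n k : ℕ} (h : k ≤ n) :
    qBinom q (n + 1) (k + 1) = qBinom q n (k + 1) + q ^ (n - k) * qBinom q n k := by
  rcases h.eq_or_lt with rfl | h
  · simp [qBinom_self hq, qBinom_of_lt]
  · obtain ⟨m, rfl⟩ := Nat.exists_eq_add_of_lt h
    have e1 : k + m + 1 + 1 - (k + 1) = m + 1 := by lia
    have e2 : k + m + 1 - (k + 1) = m := by lia
    have e3 : k + m + 1 - k = m + 1 := by lia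
    rw [qBinom, qBinom, qBinom, if_pos (by lia), if_pos (by lia), if_pos (by lia), e1, e2, e3]
    have h1 := qRising_self_ne_zero hq k
    have h2 := qRising_self_ne_zero hq m
    have h3 := one_sub_mul_pow_ne_zero hq k
    have h4 := one_sub_mul_pow_ne_zero hq m
    rw [qRising_succ q q (k + m + 1), qRising_succ q q k, qRising_succ q q m]
    field_simp
    ring

end QBinom

/-! ### The double sum formula -/

section DoubleSum

/-- The summand of the double sum formula for `denomPoly`. -/
noncomputable def denomTerm (q a lam : ℝ) (n j k : ℕ) : ℝ[X] :=
  C (qBinom q k j * qBinom q (n - j) k * a ^ (k - j) * lam ^ j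
    * q ^ (k.choose 2 + j.choose 2 + j)) * X ^ (n - j - k)

variable {q : ℝ} (a lam : ℝ)

/-- Lets square index ranges replace the range `j ≤ k ≤ n - j`. -/
theorem denomTerm_eq_zero {n j k : ℕ} (h : k < j ∨ n < j + k) : denomTerm q a lam n j k = 0 := by
  rcases lt_or_ge k j with h1 | h1
  · simp [denomTerm, qBinom_of_lt h1]
  · have : n - j < k := by lia
    simp [denomTerm, qBinom_of_lt this]

theorem denomTerm_succ_zero_zero (hq : |q| < 1) (n : ℕ) :
    denomTerm q a lam (n + 1) 0 0 = X * denomTerm q a lam n 0 0 := by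
  simp [denomTerm, qBinom_zero_right hq, pow_succ']

theorem denomTerm_succ_zero_succ (hq : |q| < 1) (n k : ℕ) :
    denomTerm q a lam (n + 1) 0 (k + 1) =
      X * denomTerm q a lam n 0 (k + 1) + C (a * q ^ n) * denomTerm q a lam n 0 k := by
  rcases lt_or_ge n k with h | h
  · rw [denomTerm_eq_zero, denomTerm_eq_zero, denomTerm_eq_zero] <;> first | lia | simp
  have hp : q ^ n = q ^ (n - k) * q ^ k := by rw [← pow_add]; congr 1; lia
  have hch : (k + 1).choose 2 = k + k.choose 2 := by simp [Nat.choose_succ_succ' k 1]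
  rcases h.eq_or_lt with rfl | h
  · simp only [denomTerm, Nat.sub_zero, qBinom_zero_right hq, qBinom_self hq,
      qBinom_of_lt (Nat.lt_succ_self k), hch]
    simp
    ring
  · obtain ⟨m, rfl⟩ := Nat.exists_eq_add_of_lt h
    have e1 : k + m + 1 + 1 - (k + 1) = m + 1 := by lia
    have e2 : k + m + 1 - (k + 1) = m := by lia
    have e3 : k + m + 1 - k = m + 1 := by lia
    simp only [denomTerm, Nat.sub_zero, qBinom_zero_right hq, qBinom_succ_succ' hq h.le, hp, hch,
      e1, e2, e3]
    simp only [map_mul, map_add, map_pow]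
    ring

/-- `qBinom_succ_succ'` on the factor with top `n + 1 - j` splits off the `X` term;
`qBinom_succ_succ` on the factor with top `k + 1` then splits the rest into the `a` and `lam` terms.
-/
theorem denomTerm_succ_succ_succ (hq : |q| < 1) (n j k : ℕ) :
    denomTerm q a lam (n + 2) (j + 1) (k + 1) =
      X * denomTerm q a lam (n + 1) (j + 1) (k + 1)
        + C (a * q ^ (n + 1)) * denomTerm q a lam (n + 1) (j + 1) k
        + C (lam * q ^ (n + 1)) * denomTerm q a lam n j k := by
  rcases lt_or_ge k j with h | h
  · rw [denomTerm_eq_zero, denomTerm_eq_zero, denomTerm_eq_zero, denomTerm_eq_zero] <;> first | lia | simp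
  rcases lt_or_ge n (j + k) with h' | h'
  · rw [denomTerm_eq_zero, denomTerm_eq_zero, denomTerm_eq_zero, denomTerm_eq_zero] <;> first | lia | simp
  obtain ⟨d, rfl⟩ := Nat.exists_eq_add_of_le h
  obtain ⟨m, rfl⟩ := Nat.exists_eq_add_of_le h'
  have hch : ∀ i : ℕ, (i + 1).choose 2 = i + i.choose 2 := fun i => by
    simp [Nat.choose_succ_succ' i 1]
  have e0 : j + (j + d) + m + 2 - (j + 1) = j + d + m + 1 := by lia
  have e1 : j + (j + d) + m + 1 - (j + 1) = j + d + m := by lia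
  have e2 : j + (j + d) + m - j = j + d + m := by lia
  have e3 : j + d + m - (j + d) = m := by lia
  have e4 : j + d + 1 - (j + 1) = d := by lia
  have e5 : j + d - j = d := by lia
  have e6 : j + d + m + 1 - (j + d + 1) = m := by lia
  have hP := qBinom_succ_succ' hq (Nat.le_add_right (j + d) m)
  -- Truncated subtraction spoils the exponent only for `m = 0`, where the q-binomial vanishes;
  -- likewise for `d = 0` in `hA`.
  have hX : (X : ℝ[X]) * (C (qBinom q (j + d + m) (j + d + 1)) * X ^ (j + d + m - (j + d + 1)))
      = C (qBinom q (j + d + m) (j + d + 1)) * X ^ m := by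
    rcases m with _ | m
    · simp [qBinom_of_lt]
    · rw [show j + d + (m + 1) - (j + d + 1) = m by lia]; ring
  have hA : C (a * a ^ (j + d - (j + 1))) * C (qBinom q (j + d) (j + 1)) =
      C (a ^ d) * C (qBinom q (j + d) (j + 1)) := by
    rcases d with _ | d
    · simp [qBinom_of_lt]
    · rw [show j + (d + 1) - (j + 1) = d by lia, pow_succ']
  simp only [denomTerm, e0, e1, e2, e3, e4, e5, e6]
  rw [e3] at hP
  rw [hP]
  have hK := qBinom_succ_succ hq (j + d) j
  rw [hch, hch]
  simp only [map_mul, map_add, map_pow] at hX hA ⊢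
  set A := C (qBinom q (j + d + m) (j + d + 1))
  set B := C (qBinom q (j + d + m) (j + d))
  have hK' : C (qBinom q (j + d + 1) (j + 1)) =
      C q ^ (j + 1) * C (qBinom q (j + d) (j + 1)) + C (qBinom q (j + d) j) := by
    rw [hK]; simp
  linear_combination (-(C (qBinom q (j + d + 1) (j + 1)) * C a ^ d * C lam ^ (j + 1)
      * C q ^ ((j + d + (j + d).choose 2) + (j + j.choose 2) + (j + 1)))) * hX
    - C q ^ (j + (j + d) + m + 1) * B * C lam ^ (j + 1)
      * C q ^ ((j + d).choose 2 + (j + j.choose 2) + (j + 1)) * X ^ m * hA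
    + (C a ^ d * C lam ^ (j + 1) * B * X ^ m
      * C q ^ (m + (j + d + (j + d).choose 2) + (j + j.choose 2) + (j + 1))) * hK'

/-- The box size `N` is left free because the index shift calls for two different sizes in the
induction step. -/
theorem denomPoly_eq_sum_denomTerm (hq : |q| < 1) (n : ℕ) : ∀ N, n < N →
    denomPoly q a lam n =
      ∑ j ∈ Finset.range N, ∑ k ∈ Finset.range N, denomTerm q a lam n j k := by
  induction n using Nat.twoStepInduction with
  | zero =>
    intro N hN
    obtain ⟨N, rfl⟩ := Nat.exists_eq_add_of_lt hN
    rw [Finset.sum_eq_single 0, Finset.sum_eq_single 0]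
    · simp [denomPoly, denomTerm, qBinom_self hq]
    · exact fun k _ hk => denomTerm_eq_zero a lam (by lia)
    · simp
    · exact fun j _ hj => Finset.sum_eq_zero fun k _ => denomTerm_eq_zero a lam (by lia)
    · simp
  | one =>
    intro N hN
    obtain ⟨N, rfl⟩ := Nat.exists_eq_add_of_lt hN
    rw [Finset.sum_eq_single 0, Finset.sum_eq_add_of_mem 0 1 (by simp) (by simp) (by simp)]
    · simp [denomPoly, denomTerm, qBinom_self hq, qBinom_zero_right hq]
    · exact fun k _ hk => denomTerm_eq_zero a lam (by lia)
    · exact fun j _ hj => Finset.sum_eq_zero fun k _ => denomTerm_eq_zero a lam (by lia)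
    · simp
  | more n ih ih' =>
    intro N hN
    obtain ⟨N, rfl⟩ := Nat.exists_eq_add_of_lt hN
    set M := n + 2 + N with hM
    have hzero : ∀ n j, n < M → denomTerm q a lam n j M = 0 := fun n j h =>
      denomTerm_eq_zero a lam (by lia)
    have hrow : ∀ j, ∑ k ∈ Finset.range (M + 1), denomTerm q a lam (n + 1) j k =
        ∑ k ∈ Finset.range M, denomTerm q a lam (n + 1) j k := fun j => by
      rw [Finset.sum_range_succ, hzero _ _ (by lia), add_zero]
    have hrow' : ∀ j, denomTerm q a lam (n + 1) (j + 1) 0 = 0 := fun j =>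
      denomTerm_eq_zero a lam (by lia)
    have hrow'' : ∀ j, denomTerm q a lam (n + 2) (j + 1) 0 = 0 := fun j =>
      denomTerm_eq_zero a lam (by lia)
    have h1 : ∀ j, ∑ k ∈ Finset.range (M + 1), denomTerm q a lam (n + 2) (j + 1) k =
        (X + C (a * q ^ (n + 1))) *
            ∑ k ∈ Finset.range (M + 1), denomTerm q a lam (n + 1) (j + 1) k
          + C (lam * q ^ (n + 1)) * ∑ k ∈ Finset.range M, denomTerm q a lam n j k := fun j => by
      rw [add_mul]
      conv_rhs => enter [1, 2]; rw [hrow]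
      rw [Finset.sum_range_succ', Finset.sum_range_succ', hrow', hrow'']
      simp only [denomTerm_succ_succ_succ a lam hq, Finset.sum_add_distrib, ← Finset.mul_sum,
        add_zero]
    have h0 : ∑ k ∈ Finset.range (M + 1), denomTerm q a lam (n + 2) 0 k =
        (X + C (a * q ^ (n + 1))) *
            ∑ k ∈ Finset.range (M + 1), denomTerm q a lam (n + 1) 0 k := by
      rw [add_mul]
      conv_rhs => enter [2]; rw [hrow]
      rw [Finset.sum_range_succ', Finset.sum_range_succ', denomTerm_succ_zero_zero a lam hq]
      simp only [denomTerm_succ_zero_succ a lam hq, Finset.sum_add_distrib, ← Finset.mul_sum]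
      ring
    rw [Finset.sum_range_succ', h0]
    simp only [h1, Finset.sum_add_distrib, ← Finset.mul_sum]
    rw [denomPoly, ih M (by lia), ih' (M + 1) (by lia), Finset.sum_range_succ' (n := M)]
    ring

end DoubleSum

/-! ### The single sum formula -/

section SingleSum

variable {q : ℝ} (a lam : ℝ)

/-- The summand of the single sum formula for `denomPoly`. -/
noncomputable def denomProdTerm (q a lam x : ℝ) (n j : ℕ) : ℝ :=
  qBinom q (n - j) j * (∏ i ∈ Finset.Ico j (n - j), (x + a * q ^ i)) * lam ^ j * q ^ (j ^ 2)

theorem denomProdTerm_eq_zero (x : ℝ) {n j : ℕ} (h : n < 2 * j) :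
    denomProdTerm q a lam x n j = 0 := by
  simp [denomProdTerm, qBinom_of_lt (show n - j < j by lia)]

theorem denomProdTerm_succ_zero (hq : |q| < 1) (x : ℝ) (n : ℕ) :
    denomProdTerm q a lam x (n + 1) 0 = (x + a * q ^ n) * denomProdTerm q a lam x n 0 := by
  simp [denomProdTerm, qBinom_zero_right hq, Finset.prod_range_succ, mul_comm]

/-- After removing the common product, the coefficient of `x` is one q-Pascal rule and that of `a`
is the other. -/
theorem denomProdTerm_succ_succ (hq : |q| < 1) (x : ℝ) (n j : ℕ) :
    denomProdTerm q a lam x (n + 2) (j + 1) =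
      (x + a * q ^ (n + 1)) * denomProdTerm q a lam x (n + 1) (j + 1)
        + lam * q ^ (n + 1) * denomProdTerm q a lam x n j := by
  rcases lt_or_ge n (2 * j) with h | h
  · rw [denomProdTerm_eq_zero, denomProdTerm_eq_zero, denomProdTerm_eq_zero] <;> first | lia | simp
  obtain ⟨m, rfl⟩ := Nat.exists_eq_add_of_le h
  have e0 : 2 * j + m + 2 - (j + 1) = j + m + 1 := by lia
  have e1 : 2 * j + m + 1 - (j + 1) = j + m := by lia
  have e2 : 2 * j + m - j = j + m := by lia
  simp only [denomProdTerm, e0, e1, e2]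
  rcases m with _ | m
  · simp [qBinom_self hq, qBinom_of_lt]
    ring
  · have hP := qBinom_succ_succ hq (j + (m + 1)) j
    have hP' := qBinom_succ_succ' hq (Nat.le_add_right j (m + 1))
    rw [Nat.add_sub_cancel_left] at hP'
    rw [Finset.prod_Ico_succ_top (by lia), Finset.prod_eq_prod_Ico_succ_bot (a := j) (by lia)]
    set B := qBinom q (j + (m + 1) + 1) (j + 1)
    set P := ∏ i ∈ Finset.Ico (j + 1) (j + (m + 1)), (x + a * q ^ i)
    linear_combination P * lam ^ (j + 1) * q ^ ((j + 1) ^ 2) *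
      (x * hP' + a * q ^ (j + (m + 1)) * hP)

theorem eval_denomPoly_eq_sum_denomProdTerm (hq : |q| < 1) (x : ℝ) (n : ℕ) : ∀ N, n < N →
    (denomPoly q a lam n).eval x = ∑ j ∈ Finset.range N, denomProdTerm q a lam x n j := by
  induction n using Nat.twoStepInduction with
  | zero =>
    intro N hN
    rw [Finset.sum_eq_single 0]
    · simp [denomPoly, denomProdTerm, qBinom_self hq]
    · exact fun j _ hj => denomProdTerm_eq_zero a lam x (by lia)
    · simp; lia
  | one =>
    intro N hN
    rw [Finset.sum_eq_single 0]
    · simp [denomPoly, denomProdTerm, qBinom_zero_right hq]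
    · exact fun j _ hj => denomProdTerm_eq_zero a lam x (by lia)
    · simp; lia
  | more n ih ih' =>
    intro N hN
    obtain ⟨N, rfl⟩ := Nat.exists_eq_add_of_lt hN
    rw [Finset.sum_range_succ', denomProdTerm_succ_zero a lam hq]
    simp only [denomProdTerm_succ_succ a lam hq, Finset.sum_add_distrib, ← Finset.mul_sum]
    rw [denomPoly, eval_add, eval_mul, eval_mul, ih (n + 2 + N) (by lia),
      ih' (n + 2 + N + 1) (by lia), Finset.sum_range_succ' (n := n + 2 + N)]
    simp
    ring

/-- The quotient leaves the factors with `j ≤ i < n - j`; each of these `n - 2j` factors absorbs one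
`x`. -/
theorem denomProdTerm_eq_qRising_div {x : ℝ} (hx : x ≠ 0) {n j : ℕ} (h : 2 * j ≤ n)
    (hj : qRising (-a / x) q j ≠ 0) :
    denomProdTerm q a lam x n j =
      qBinom q (n - j) j * (qRising (-a / x) q (n - j) / qRising (-a / x) q j)
        * lam ^ j * x ^ ((n : ℤ) - 2 * (j : ℤ)) * q ^ (j ^ 2) := by
  have h1 : qRising (-a / x) q (n - j) / qRising (-a / x) q j =
      ∏ i ∈ Finset.Ico j (n - j), (1 - -a / x * q ^ i) := by
    rw [div_eq_iff hj, mul_comm, qRising, qRising, Finset.prod_range_mul_prod_Ico _ (by lia)]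
  have h2 : (n : ℤ) - 2 * (j : ℤ) = ((n - j - j : ℕ) : ℤ) := by lia
  have h3 : ∏ i ∈ Finset.Ico j (n - j), (x + a * q ^ i) =
      (∏ i ∈ Finset.Ico j (n - j), (1 - -a / x * q ^ i)) * x ^ (n - j - j) := by
    rw [← Nat.card_Ico j (n - j), ← Finset.prod_const, ← Finset.prod_mul_distrib]
    refine Finset.prod_congr rfl fun i _ => ?_
    field_simp
    ring
  rw [h1, h2, zpow_natCast, denomProdTerm, h3]
  ring

end SingleSum

theorem mainTheorem5 (q a lam : ℝ) (hq0 : 0 < |q|) (hq1 : |q| < 1) (hlam : lam < 0) :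
    (∀ n : ℕ, denomPoly q a lam n =
      ∑ j ∈ Finset.range (n + 1), ∑ k ∈ Finset.range (n + 1),
        C (qBinom q k j * qBinom q (n - j) k * a ^ (k - j) * lam ^ j
          * q ^ (k.choose 2 + j.choose 2 + j)) * X ^ (n - j - k)) ∧
    (∀ (n : ℕ) (x : ℝ), x ≠ 0 → (∀ j : ℕ, 2 * j ≤ n → qRising (-a / x) q j ≠ 0) →
      (denomPoly q a lam n).eval x =
        ∑ j ∈ Finset.range (n + 1),
          qBinom q (n - j) j * (qRising (-a / x) q (n - j) / qRising (-a / x) q j)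
            * lam ^ j * x ^ ((n : ℤ) - 2 * (j : ℤ)) * q ^ (j ^ 2)) ∧
    (0 < q → ∃ μ : Measure ℝ, IsPurelyDiscrete μ ∧
      ∀ n m : ℕ,
        Integrable (fun x => (denomPoly q a lam n).eval x * (denomPoly q a lam m).eval x) μ ∧
        ∫ x, (denomPoly q a lam n).eval x * (denomPoly q a lam m).eval x ∂μ =
          if n = m then (-lam) ^ n * q ^ ((n + 1).choose 2) else 0) := by
  refine ⟨fun n => denomPoly_eq_sum_denomTerm a lam hq1 n (n + 1) n.lt_succ_self,
    fun n x hx hne => ?_, fun hq => exists_isPurelyDiscrete_orthogonality a hq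
      ((le_abs_self q).trans_lt hq1) hlam⟩
  rw [eval_denomPoly_eq_sum_denomProdTerm a lam hq1 x n (n + 1) n.lt_succ_self]
  refine Finset.sum_congr rfl fun j _ => ?_
  rcases le_or_gt (2 * j) n with h | h
  · exact denomProdTerm_eq_qRising_div a lam hx h (hne j h)
  -- For `2 * j > n` the q-binomial vanishes, so a zero denominator or negative exponent does no
  -- harm.
  · rw [denomProdTerm_eq_zero a lam x h, qBinom_of_lt (show n - j < j by lia)]
    ring
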